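/- Let $f$ be a real quadratic polynomial whose critical point $x_0$ is periodic under $f$ with exact period $p\ge 1$. Let $T=\bigcup_{i,j\ge 0}[f^i(x_0),f^j(x_0)]\subset\mathbb R$ be its Hubbard tree (here $[a,b]$ is the real segment with endpoints $a,b$), and let $\mathcal P=\{f^n(x_0):n\ge 1\}$ be its postcritical set. Then $T\setminus\mathcal P$ has finitely many connected components. Let $A$ be the transition matrix of this partition, indexed by the components of $T\setminus\mathcal P$, with $A_{J,K}=1$ if $f(J)\supseteq K$ and $A_{J,K}=0$ otherwise. Let $D_{MT}(t)\in\mathbb Z[[t]]$ be the Milnor--Thurston kneading determinant of $f$, defined as follows. Let $I_1=\{x\le x_0\}$ and $I_2=\{x\ge x_0\}$ be the laps of $f$, with $\varepsilon(I_j)=+1$ or $-1$ according to whether $f$ is increasing or decreasing on $I_j$. Let $A_n(x_0^{+})$ (respectively $A_n(x_0^{-})$) be the lap containing $f^n(y)$ for all $y>x_0$ (respectively $y<x_0$) sufficiently close to $x_0$. Put $$\theta(x_0^{\pm})=\sum_{n\ge 0}\varepsilon(A_0(x_0^\pm))\cdots\varepsilon(A_{n-1}(x_0^\pm))\,A_n(x_0^\pm)\,t^n,\qquad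 \theta(x_0^+)-\theta(x_0^-)=N_{11}(t)\,I_1+N_{12}(t)\,I_2,$$ where $I_1,I_2$ are treated as formal basis vectors, and $D_{MT}(t)=N_{12}(t)/(1-\varepsilon(I_1)t)$. Then $P_{MT}(t):=(1-t^p)D_{MT}(t)$ is a polynomial of degree $p-1$ (the Milnor--Thurston kneading polynomial), and $$\det(I-tA)=P_{MT}(t).$$ -/

import Mathlib

noncomputable section

namespace RealQuadratic

/-- The postcritical set of `f` with critical point `x₀`: the forward orbit of the critical
value `f x₀`. (If `x₀` is periodic, it contains `x₀`.) -/
def postcriticalSet (f : ℝ → ℝ) (x₀ : ℝ) : Set ℝ :=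
  Set.range fun n : ℕ => f^[n + 1] x₀

/-- The Hubbard tree of a real quadratic map with critical point `x₀`: the union of the arcs
`[f^i(x₀), f^j(x₀)]`, `i, j ≥ 0`. The orbit of `x₀` is real, so these arcs are real segments. -/
def hubbardTree (f : ℝ → ℝ) (x₀ : ℝ) : Set ℝ :=
  ⋃ (i : ℕ) (j : ℕ), Set.uIcc (f^[i] x₀) (f^[j] x₀)

/-- The postcritical partition: the set of connected components of the Hubbard tree minus the
postcritical set. -/
def postcriticalPartition (f : ℝ → ℝ) (x₀ : ℝ) : Set (Set ℝ) :=
  {J | ∃ x ∈ hubbardTree f x₀ \ postcriticalSet f x₀,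
    J = connectedComponentIn (hubbardTree f x₀ \ postcriticalSet f x₀) x}

open Classical in
/-- The transition matrix of the postcritical partition: the entry at `(J, K)` is `1` if `f(J)`
covers `K`, and `0` otherwise. -/
def transitionMatrix (f : ℝ → ℝ) (x₀ : ℝ) :
    Matrix (postcriticalPartition f x₀) (postcriticalPartition f x₀) ℤ :=
  Matrix.of fun J K => if (K : Set ℝ) ⊆ f '' (J : Set ℝ) then 1 else 0

open Classical in
/-- The orientation sign of a map which is strictly monotone on `s`. -/
def orientationSign (f : ℝ → ℝ) (s : Set ℝ) : ℤ :=
  if StrictMonoOn f s then 1 else -1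

/-- The sign `ε` of an address. A unimodal map with turning point `x₀` has two laps: the left one
`I₁ = {x ≤ x₀}`, denoted by the address `-1`, and the right one `I₂ = {x ≥ x₀}`, denoted by the
address `1`. The address `0` is that of `x₀` itself, with sign `0`. -/
def lapSign (f : ℝ → ℝ) (x₀ : ℝ) : SignType → ℤ
  | .neg => orientationSign f (Set.Iic x₀)
  | .zero => 0
  | .pos => orientationSign f (Set.Ici x₀)

/-- The address `A_n(y)` of the point `f^n(y)`. -/
def address (f : ℝ → ℝ) (x₀ : ℝ) (n : ℕ) (y : ℝ) : SignType :=
  SignType.sign (f^[n] y - x₀)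

/-- The limit address along a filter `l`: for `l = 𝓝[>] x` this is `A_n(x⁺)`, and for
`l = 𝓝[<] x` it is `A_n(x⁻)`. -/
def limitAddress (f : ℝ → ℝ) (x₀ : ℝ) (l : Filter ℝ) (n : ℕ) : SignType :=
  Filter.limUnder l (address f x₀ n)

/-- The coefficient of the lap `J` in the invariant coordinate `θ(x^±) = ∑ θ_n(x^±) t^n`, where
`θ_n = ε(A_0) ⋯ ε(A_{n-1}) A_n` is a formal linear combination of the laps. -/
def invariantCoordinate (f : ℝ → ℝ) (x₀ : ℝ) (l : Filter ℝ) (J : SignType) : PowerSeries ℤ :=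
  PowerSeries.mk fun n =>
    (∏ i ∈ Finset.range n, lapSign f x₀ (limitAddress f x₀ l i)) *
      if limitAddress f x₀ l n = J then 1 else 0

open Topology in
/-- The kneading increment `ν = θ(x₀⁺) - θ(x₀⁻) = N₁₁ I₁ + N₁₂ I₂` at the turning point: the
coefficient of the lap `J`. -/
def kneadingIncrement (f : ℝ → ℝ) (x₀ : ℝ) (J : SignType) : PowerSeries ℤ :=
  invariantCoordinate f x₀ (𝓝[>] x₀) J - invariantCoordinate f x₀ (𝓝[<] x₀) J

/-- The Milnor–Thurston kneading determinant of a unimodal map with turning point `x₀`. The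
kneading matrix is the row `(N₁₁, N₁₂)`; deleting its first column leaves `N₁₂`, and the kneading
determinant is `N₁₂ / (1 - ε(I₁) t)`. -/
def kneadingDeterminant (f : ℝ → ℝ) (x₀ : ℝ) : PowerSeries ℤ :=
  kneadingIncrement f x₀ 1 *
    PowerSeries.invOfUnit (1 - PowerSeries.C (lapSign f x₀ (-1)) * PowerSeries.X) 1

end RealQuadratic

end

/-! Write `x_i = f^i(x₀)`, `σ` for the sign of the leading coefficient, and `e_i` for the product of
`σ · sign(x_l - x₀)` over `1 ≤ l ≤ i`. For `i < p` this is `kneadingSign`.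

Matrix side: a vector `v` on the components of `T \ P` is a step function. Let `H_v(x)` be its sum
over the components from `x₀` to `x`, with orientation. Since `f` is monotone on each side of `x₀`,
`H_{Av}(x_i) = σ sign(x_i - x₀) (H_v(x_{i+1}) - H_v(x_1))`. The values of `H_v` at `x_1, …, x_{p-1}`
determine `v`, so they serve as coordinates (`det_gapIntegrationMatrix_ne_zero`). In them `A`
becomes a companion-like matrix (`gapIntegrationMatrix_mul`), and `det_one_sub_companion` gives
`det(I - tA) = ∑_{i<p} e_i t^i`.

Kneading side: near `x₀` the map is even, so the two itineraries differ only at time `0`, and the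
signed itinerary gives `D_MT = ∑ e_n t^n` (`eventually_sign_iterate`, `kneadingDeterminant_eq`).
This sequence has period `p`, so multiplying by `1 - t^p` truncates it to the same polynomial. -/

/-! ### Linear algebra: a companion determinant and a telescoping sum. -/

/-- The determinant of `1 - M`, where `M` is the matrix of
`H ↦ (i ↦ u i * (H (i + 1) - H 0))` and `H n` is read as `0`. -/
theorem det_one_sub_companion {R : Type*} [CommRing R] (n : ℕ) (u : ℕ → R) :
    (Matrix.of fun i j : Fin n => (if i = j then 1 else 0) -
      u i * ((if (j : ℕ) = i + 1 then 1 else 0) - if (j : ℕ) = 0 then 1 else 0)).det =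
    ∑ i ∈ Finset.range (n + 1), ∏ l ∈ Finset.range i, u l := by
  rcases n with _ | n
  · simp
  set N : Matrix (Fin (n + 1)) (Fin (n + 1)) R := Matrix.of fun i j => (if i = j then 1 else 0) -
      u i * ((if (j : ℕ) = i + 1 then 1 else 0) - if (j : ℕ) = 0 then 1 else 0) with hN
  set v : Fin (n + 1) → R := fun i => ∏ l ∈ Finset.range i, u l with hv
  -- The weights `v k` make the entries `1` and `-u k` above and on the diagonal cancel in every
  -- column but the first, where the whole determinant is collected.
  have hrow0 : (∑ k, v k • N k) 0 = ∑ i ∈ Finset.range (n + 2), ∏ l ∈ Finset.range i, u l := by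
    rw [Finset.sum_range_succ', ← Fin.sum_univ_eq_sum_range
      (fun i => ∏ l ∈ Finset.range (i + 1), u l)]
    simp only [Finset.sum_apply, Pi.smul_apply, smul_eq_mul]
    have : ∀ k : Fin (n + 1), v k * N k 0 =
        (∏ l ∈ Finset.range ((k : ℕ) + 1), u l) + if k = 0 then 1 else 0 := by
      intro k
      by_cases h : k = 0
      · subst h; simp [hN, hv, add_comm]
      · simp [hN, hv, h, Finset.prod_range_succ]
    simp [this, Finset.sum_add_distrib]
  have hrow : ∀ j : Fin n, (∑ k, v k • N k) j.succ = 0 := by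
    intro j
    simp only [Finset.sum_apply, Pi.smul_apply, smul_eq_mul]
    have : ∀ k : Fin (n + 1), v k * N k j.succ =
        (if k = j.succ then v j.succ else 0) - if k = j.castSucc then v j.succ else 0 := by
      intro k
      by_cases h : k = j.succ
      · simp [hN, h, Fin.castSucc_lt_succ.ne']
      · by_cases h' : k = j.castSucc
        · simp [hN, hv, h', Fin.castSucc_lt_succ.ne, Finset.prod_range_succ]
        · have h'' : ¬ ((j : ℕ) = k) := fun e => h' (Fin.ext e.symm)
          simp [hN, h, h', h'']
    simp [this]
  -- The weight of row `0` is an empty product, hence `1`, so this row operation preserves the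
  -- determinant.
  have hdet : (N.updateRow 0 (∑ k, v k • N k)).det = N.det := by
    rw [Matrix.det_updateRow_sum]
    simp [hv]
  rw [← hdet, Matrix.det_succ_row_zero, Fin.sum_univ_succ]
  have hminor : (N.submatrix Fin.succ Fin.succ).det = 1 := by
    rw [Matrix.det_of_isUpperTriangular]
    · exact Finset.prod_eq_one fun i _ => by simp [hN]
    · intro i j hij
      have hij' : (j : ℕ) < i := hij
      have h1 : i ≠ j := fun h => by subst h; omega
      have h2 : ¬ ((j : ℕ) = i + 1) := by omega
      simp [hN, h1, h2]
  have hsub : ((N.updateRow 0 (∑ k, v k • N k)).submatrix Fin.succ (Fin.succAbove 0)) =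
      N.submatrix Fin.succ Fin.succ := by
    ext i j
    simp [Matrix.updateRow_ne]
  rw [hsub, hminor]
  simp only [Matrix.updateRow_self, hrow0, hrow]
  simp

theorem Fin.sum_ite_castSucc_lt_sub {n : ℕ} {M : Type*} [AddCommGroup M] (F : Fin (n + 1) → M)
    (r : Fin (n + 1)) :
    (∑ j : Fin n, if j.castSucc < r then F j.succ - F j.castSucc else 0) = F r - F 0 := by
  induction r using Fin.induction with
  | zero => simp
  | succ r ih =>
    have : ∀ j : Fin n, (if j.castSucc < r.succ then F j.succ - F j.castSucc else 0) =
        (if j.castSucc < r.castSucc then F j.succ - F j.castSucc else 0) +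
          if j = r then F r.succ - F r.castSucc else 0 := by
      intro j
      rcases lt_trichotomy j r with h | h | h
      · simp [h, h.ne, h.le]
      · simp [h]
      · simp [h.not_gt, h.ne', h.not_ge]
    rw [Finset.sum_congr rfl fun j _ => this j, Finset.sum_add_distrib, ih]
    simp

/-! ### Kneading signs, itineraries and the kneading determinant. -/

namespace RealQuadratic

/-- The sign `ε(A₁) ⋯ ε(Aₙ)` for the limit addresses `Aᵢ` of the turning point `x₀` of a unimodal
map which is increasing to the right of `x₀` if `σ = 1` and decreasing if `σ = -1`. -/
noncomputable def kneadingSign (f : ℝ → ℝ) (x₀ : ℝ) (σ : SignType) : ℕ → SignType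
  | 0 => 1
  | n + 1 => if f^[n + 1] x₀ = x₀ then 1 else
      σ * SignType.sign (f^[n + 1] x₀ - x₀) * kneadingSign f x₀ σ n

theorem kneadingSign_ne_zero {f : ℝ → ℝ} {x₀ : ℝ} {σ : SignType} (hσ : σ ≠ 0) (n : ℕ) :
    kneadingSign f x₀ σ n ≠ 0 := by
  induction n with
  | zero => simp [kneadingSign]
  | succ n ih =>
    rw [kneadingSign]
    split_ifs with h
    · simp
    · have : SignType.sign (f^[n + 1] x₀ - x₀) ≠ 0 := by
        rw [Ne, sign_eq_zero_iff, sub_eq_zero]; exact h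
      exact mul_ne_zero (mul_ne_zero hσ this) ih

/-- The recursion resets to `1` at each return to `x₀`, and between returns it depends only on the
orbit. -/
theorem kneadingSign_add_period {f : ℝ → ℝ} {x₀ : ℝ} (σ : SignType) {p : ℕ} (hp : 0 < p)
    (h : Function.IsPeriodicPt f p x₀) (n : ℕ) :
    kneadingSign f x₀ σ (n + p) = kneadingSign f x₀ σ n := by
  induction n with
  | zero =>
    obtain ⟨m, rfl⟩ := Nat.exists_eq_add_one_of_ne_zero hp.ne'
    rw [Nat.zero_add]
    simp only [kneadingSign]
    exact if_pos h.eq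
  | succ n ih =>
    have : f^[n + p + 1] x₀ = f^[n + 1] x₀ := by
      rw [show n + p + 1 = (n + 1) + p by ring, Function.iterate_add_apply, h.eq]
    rw [show n + 1 + p = n + p + 1 by ring, kneadingSign, kneadingSign, this, ih]

section Quadratic

variable {f : ℝ → ℝ} {a b x₀ : ℝ}

theorem strictMonoOn_Ici (ha : 0 < a) (hf : ∀ x, f x = a * (x - x₀) ^ 2 + b) :
    StrictMonoOn f (Set.Ici x₀) := by
  intro x hx y hy hxy
  simp only [Set.mem_Ici] at hx hy
  have : 0 < a * ((y - x) * (y + x - 2 * x₀)) :=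
    mul_pos ha (mul_pos (by linarith) (by linarith))
  rw [hf, hf]; linarith

theorem strictAntiOn_Iic (ha : 0 < a) (hf : ∀ x, f x = a * (x - x₀) ^ 2 + b) :
    StrictAntiOn f (Set.Iic x₀) := by
  intro x hx y hy hxy
  simp only [Set.mem_Iic] at hx hy
  have : 0 < a * ((y - x) * (2 * x₀ - y - x)) :=
    mul_pos ha (mul_pos (by linarith) (by linarith))
  rw [hf, hf]; linarith

theorem strictAntiOn_Ici (ha : a < 0) (hf : ∀ x, f x = a * (x - x₀) ^ 2 + b) :
    StrictAntiOn f (Set.Ici x₀) := by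
  have h := strictMonoOn_Ici (f := -f) (a := -a) (b := -b) (x₀ := x₀) (neg_pos.2 ha)
    fun x => by rw [Pi.neg_apply, hf]; ring
  simpa [Pi.neg_def] using h.neg

theorem strictMonoOn_Iic (ha : a < 0) (hf : ∀ x, f x = a * (x - x₀) ^ 2 + b) :
    StrictMonoOn f (Set.Iic x₀) := by
  have h := strictAntiOn_Iic (f := -f) (a := -a) (b := -b) (x₀ := x₀) (neg_pos.2 ha)
    fun x => by rw [Pi.neg_apply, hf]; ring
  simpa [Pi.neg_def] using h.neg

theorem lapSign_eq (ha : a ≠ 0) (hf : ∀ x, f x = a * (x - x₀) ^ 2 + b) (s : SignType) :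
    lapSign f x₀ s = ((SignType.sign a * s : SignType) : ℤ) := by
  have not_both : ∀ g : ℝ → ℝ, ∀ u v, u ∈ ({Set.Iic x₀, Set.Ici x₀} : Set (Set ℝ)) → v = u →
      StrictAntiOn g u → ¬ StrictMonoOn g v := by
    rintro g u v hu rfl h1 h2
    rcases hu with rfl | rfl
    · exact lt_asymm (h1 (by simp : x₀ - 1 ∈ Set.Iic x₀) (by simp : x₀ ∈ Set.Iic x₀) (by simp))
        (h2 (by simp : x₀ - 1 ∈ Set.Iic x₀) (by simp : x₀ ∈ Set.Iic x₀) (by simp))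
    · exact lt_asymm (h1 (by simp : x₀ ∈ Set.Ici x₀) (by simp : x₀ + 1 ∈ Set.Ici x₀) (by simp))
        (h2 (by simp : x₀ ∈ Set.Ici x₀) (by simp : x₀ + 1 ∈ Set.Ici x₀) (by simp))
  rcases ha.lt_or_gt with h | h
  · rw [sign_neg h]
    cases s
    · simp [lapSign]
    · change orientationSign f (Set.Iic x₀) = 1
      rw [orientationSign, if_pos (strictMonoOn_Iic h hf)]
    · change orientationSign f (Set.Ici x₀) = -1
      rw [orientationSign, if_neg (not_both f _ _ (by simp) rfl (strictAntiOn_Ici h hf))]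
  · rw [sign_pos h]
    cases s
    · simp [lapSign]
    · change orientationSign f (Set.Iic x₀) = -1
      rw [orientationSign, if_neg (not_both f _ _ (by simp) rfl (strictAntiOn_Iic h hf))]
    · change orientationSign f (Set.Ici x₀) = 1
      rw [orientationSign, if_pos (strictMonoOn_Ici h hf)]

-- The sign of `f^[n + 1] y - f^[n + 1] x₀` is followed by induction on `n`. It determines the
-- address of `f^[n + 1] y` when the orbit returns to `x₀`; otherwise continuity does. Both sides of
-- `x₀` behave alike, which is why a punctured neighbourhood suffices.
open Filter Topology in
theorem eventually_sign_iterate (ha : a ≠ 0) (hf : ∀ x, f x = a * (x - x₀) ^ 2 + b) (n : ℕ) :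
    ∀ᶠ y in 𝓝[≠] x₀,
      SignType.sign (f^[n + 1] y - f^[n + 1] x₀) =
        SignType.sign a * kneadingSign f x₀ (SignType.sign a) n ∧
      SignType.sign (f^[n + 1] y - x₀) = SignType.sign a *
        kneadingSign f x₀ (SignType.sign a) (n + 1) * kneadingSign f x₀ (SignType.sign a) n := by
  have hσ : SignType.sign a ≠ 0 := by simpa [sign_eq_zero_iff] using ha
  have hcont : Continuous f := by
    rw [show f = fun x => a * (x - x₀) ^ 2 + b from funext hf]; fun_prop
  have hnear : ∀ m : ℕ, ∀ w : ℝ, f^[m] x₀ ≠ w → ∀ᶠ y in 𝓝[≠] x₀,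
      SignType.sign (f^[m] y - w) = SignType.sign (f^[m] x₀ - w) := by
    intro m w h
    have h1 : ContinuousAt (fun y => f^[m] y - w) x₀ :=
      ((hcont.iterate m).sub continuous_const).continuousAt
    refine Filter.Eventually.filter_mono nhdsWithin_le_nhds ?_
    rcases (sub_ne_zero.2 h).lt_or_gt with h2 | h2
    · filter_upwards [h1.eventually (gt_mem_nhds h2)] with y hy
      rw [sign_neg hy, sign_neg h2]
    · filter_upwards [h1.eventually (lt_mem_nhds h2)] with y hy
      rw [sign_pos hy, sign_pos h2]
  -- The second assertion follows from the first one.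
  have key : ∀ n, (∀ᶠ y in 𝓝[≠] x₀, SignType.sign (f^[n + 1] y - f^[n + 1] x₀) =
        SignType.sign a * kneadingSign f x₀ (SignType.sign a) n) →
      ∀ᶠ y in 𝓝[≠] x₀, SignType.sign (f^[n + 1] y - x₀) = SignType.sign a *
        kneadingSign f x₀ (SignType.sign a) (n + 1) * kneadingSign f x₀ (SignType.sign a) n := by
    intro n h
    by_cases hc : f^[n + 1] x₀ = x₀
    · filter_upwards [h] with y hy
      rw [kneadingSign, if_pos hc, mul_one, ← hy, hc]
    · filter_upwards [hnear _ _ hc] with y hy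
      rw [kneadingSign, if_neg hc, hy]
      have aux : ∀ σ e τ : SignType, σ ≠ 0 → e ≠ 0 → τ = σ * (σ * τ * e) * e := by decide
      exact aux _ _ _ hσ (kneadingSign_ne_zero hσ n)
  induction n with
  | zero =>
    have : ∀ᶠ y in 𝓝[≠] x₀, SignType.sign (f^[0 + 1] y - f^[0 + 1] x₀) =
        SignType.sign a * kneadingSign f x₀ (SignType.sign a) 0 := by
      filter_upwards [self_mem_nhdsWithin] with y hy
      have : 0 < (y - x₀) ^ 2 := by have := sub_ne_zero.2 hy; positivity
      simp [hf, kneadingSign, sign_mul, sign_pos this]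
    exact this.and (key 0 this)
  | succ n ih =>
    have : ∀ᶠ y in 𝓝[≠] x₀, SignType.sign (f^[n + 1 + 1] y - f^[n + 1 + 1] x₀) =
        SignType.sign a * kneadingSign f x₀ (SignType.sign a) (n + 1) := by
      -- The values of `f` at `u` and `w` agree exactly when `u = w` or `u = 2 * x₀ - w`, the
      -- reflection of `w` in the turning point.
      have hfac : ∀ y, f^[n + 1 + 1] y - f^[n + 1 + 1] x₀ = a * (f^[n + 1] y - f^[n + 1] x₀) *
          (f^[n + 1] y - (2 * x₀ - f^[n + 1] x₀)) := by
        intro y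
        rw [Function.iterate_succ_apply', Function.iterate_succ_apply' f (n + 1) x₀, hf, hf]
        ring
      by_cases hc : f^[n + 1] x₀ = x₀
      · filter_upwards [ih] with y ⟨h1, h2⟩
        rw [hfac, sign_mul, sign_mul, h1, hc, show 2 * x₀ - x₀ = x₀ by ring, h2, kneadingSign,
          if_pos hc]
        have aux : ∀ σ e : SignType, σ ≠ 0 → e ≠ 0 →
          σ * (σ * e) * (σ * 1 * e) = σ * 1 := by decide
        exact aux _ _ hσ (kneadingSign_ne_zero hσ n)
      · have hc' : f^[n + 1] x₀ ≠ 2 * x₀ - f^[n + 1] x₀ := fun h => hc (by linarith)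
        filter_upwards [ih, hnear _ _ hc'] with y ⟨h1, _⟩ h3
        have h4 : SignType.sign (f^[n + 1] x₀ - (2 * x₀ - f^[n + 1] x₀)) =
            SignType.sign (f^[n + 1] x₀ - x₀) := by
          rw [show f^[n + 1] x₀ - (2 * x₀ - f^[n + 1] x₀) = 2 * (f^[n + 1] x₀ - x₀) by ring,
            sign_mul, sign_pos two_pos, one_mul]
        rw [hfac, sign_mul, sign_mul, h1, h3, h4, kneadingSign, if_neg hc]
        have aux : ∀ σ e τ : SignType, σ * (σ * e) * τ = σ * (σ * τ * e) := by decide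
        exact aux _ _ _
    exact this.and (key _ this)

open Filter Topology in
theorem limitAddress_succ (ha : a ≠ 0) (hf : ∀ x, f x = a * (x - x₀) ^ 2 + b) {l : Filter ℝ}
    [l.NeBot] (hl : l ≤ 𝓝[≠] x₀) (n : ℕ) :
    limitAddress f x₀ l (n + 1) = SignType.sign a *
      kneadingSign f x₀ (SignType.sign a) (n + 1) * kneadingSign f x₀ (SignType.sign a) n := by
  refine Tendsto.limUnder_eq (tendsto_const_nhds.congr' ?_)
  filter_upwards [hl (eventually_sign_iterate ha hf n)] with y hy
  exact hy.2.symm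

open Filter Topology in
theorem limitAddress_zero_right (f : ℝ → ℝ) (x₀ : ℝ) : limitAddress f x₀ (𝓝[>] x₀) 0 = 1 := by
  refine Tendsto.limUnder_eq (tendsto_const_nhds.congr' ?_)
  filter_upwards [self_mem_nhdsWithin] with y hy
  exact (sign_pos (sub_pos.2 hy)).symm

open Filter Topology in
theorem limitAddress_zero_left (f : ℝ → ℝ) (x₀ : ℝ) : limitAddress f x₀ (𝓝[<] x₀) 0 = -1 := by
  refine Tendsto.limUnder_eq (tendsto_const_nhds.congr' ?_)
  filter_upwards [self_mem_nhdsWithin] with y hy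
  exact (sign_neg (sub_neg.2 hy)).symm

-- Since `ε(A) = σ A`, each later factor is the quotient of consecutive kneading signs and the
-- product telescopes; the side from which `x₀` is approached enters only through `A_0`.
open Filter Topology in
theorem prod_lapSign_limitAddress (ha : a ≠ 0) (hf : ∀ x, f x = a * (x - x₀) ^ 2 + b)
    {l : Filter ℝ} [l.NeBot] (hl : l ≤ 𝓝[≠] x₀) (n : ℕ) :
    ∏ i ∈ Finset.range (n + 1), lapSign f x₀ (limitAddress f x₀ l i) =
      ((SignType.sign a * limitAddress f x₀ l 0 * kneadingSign f x₀ (SignType.sign a) n :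
        SignType) : ℤ) := by
  induction n with
  | zero => simp [lapSign_eq ha hf, kneadingSign]
  | succ n ih =>
    rw [Finset.prod_range_succ, ih, limitAddress_succ ha hf hl, lapSign_eq ha hf,
      ← SignType.coe_mul]
    have hσ : SignType.sign a ≠ 0 := by simpa [sign_eq_zero_iff] using ha
    have aux : ∀ σ e e' τ : SignType, σ ≠ 0 → e ≠ 0 →
      σ * τ * e * (σ * (σ * e' * e)) = σ * τ * e' := by decide
    rw [aux _ _ _ _ hσ (kneadingSign_ne_zero hσ n)]

-- With `e_n` the kneading signs, the `t^n` coefficient of `N₁₂` for `n ≥ 1` is `2 σ e_{n-1}` if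
-- `A_n = 1` and `0` otherwise. As `A_n = σ e_n e_{n-1}`, this is `e_n + σ e_{n-1}`. Because `ε(I₁)
-- = -σ`, the factor `1 - ε(I₁) t = 1 + σ t` splits off.
open Filter Topology in
theorem kneadingDeterminant_eq (ha : a ≠ 0) (hf : ∀ x, f x = a * (x - x₀) ^ 2 + b) :
    kneadingDeterminant f x₀ =
      PowerSeries.mk fun n => (kneadingSign f x₀ (SignType.sign a) n : ℤ) := by
  have hσ : SignType.sign a ≠ 0 := by simpa [sign_eq_zero_iff] using ha
  have hr : 𝓝[>] x₀ ≤ 𝓝[≠] x₀ := nhdsWithin_mono _ fun y hy => ne_of_gt hy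
  have hl : 𝓝[<] x₀ ≤ 𝓝[≠] x₀ := nhdsWithin_mono _ fun y hy => ne_of_lt hy
  have hinc : kneadingIncrement f x₀ 1 =
      (PowerSeries.mk fun n => (kneadingSign f x₀ (SignType.sign a) n : ℤ)) *
        (1 - PowerSeries.C (lapSign f x₀ (-1)) * PowerSeries.X) := by
    rw [lapSign_eq ha hf]
    ext n
    rw [mul_sub, mul_one, mul_left_comm, map_sub, PowerSeries.coeff_C_mul]
    rcases n with _ | n
    · simp [kneadingIncrement, invariantCoordinate, limitAddress_zero_left,
        limitAddress_zero_right, kneadingSign]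
    · rw [PowerSeries.coeff_succ_mul_X]
      simp only [kneadingIncrement, invariantCoordinate, map_sub, PowerSeries.coeff_mk,
        prod_lapSign_limitAddress ha hf hr, prod_lapSign_limitAddress ha hf hl,
        limitAddress_zero_left, limitAddress_zero_right, limitAddress_succ ha hf hr,
        limitAddress_succ ha hf hl]
      have h1 := kneadingSign_ne_zero (f := f) (x₀ := x₀) hσ n
      have h2 := kneadingSign_ne_zero (f := f) (x₀ := x₀) hσ (n + 1)
      generalize kneadingSign f x₀ (SignType.sign a) n = e at *
      generalize kneadingSign f x₀ (SignType.sign a) (n + 1) = e' at *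
      generalize SignType.sign a = σ at *
      revert σ e e'; decide
  rw [kneadingDeterminant, hinc, mul_assoc, PowerSeries.mul_invOfUnit _ _ (by simp), mul_one]

/-- The Milnor–Thurston kneading polynomial of a quadratic map with `p`-periodic turning point. -/
noncomputable def kneadingPolynomial (f : ℝ → ℝ) (x₀ : ℝ) (σ : SignType) (p : ℕ) : Polynomial ℤ :=
  ∑ i ∈ Finset.range p, Polynomial.C (kneadingSign f x₀ σ i : ℤ) * Polynomial.X ^ i

theorem coeff_kneadingPolynomial (f : ℝ → ℝ) (x₀ : ℝ) (σ : SignType) (p n : ℕ) :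
    (kneadingPolynomial f x₀ σ p).coeff n = if n < p then (kneadingSign f x₀ σ n : ℤ) else 0 := by
  simp only [kneadingPolynomial, Polynomial.finsetSum_coeff, Polynomial.coeff_C_mul_X_pow]
  simp

theorem degree_kneadingPolynomial {f : ℝ → ℝ} {x₀ : ℝ} {σ : SignType} (hσ : σ ≠ 0) (n : ℕ) :
    (kneadingPolynomial f x₀ σ (n + 1)).degree = n := by
  refine le_antisymm ?_ ?_
  · rw [Polynomial.degree_le_iff_coeff_zero]
    intro m hm
    have : n < m := by exact_mod_cast hm
    rw [coeff_kneadingPolynomial, if_neg (by omega)]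
  · apply Polynomial.le_degree_of_ne_zero
    rw [coeff_kneadingPolynomial, if_pos (by omega)]
    have := kneadingSign_ne_zero (f := f) (x₀ := x₀) hσ n
    generalize kneadingSign f x₀ σ n = e at *
    revert e; decide

theorem coe_kneadingPolynomial (σ : SignType) {p : ℕ} (hp : 0 < p)
    (h : Function.IsPeriodicPt f p x₀) :
    (kneadingPolynomial f x₀ σ p : PowerSeries ℤ) =
      (1 - PowerSeries.X ^ p) * PowerSeries.mk fun n => (kneadingSign f x₀ σ n : ℤ) := by
  ext n
  rw [Polynomial.coeff_coe, coeff_kneadingPolynomial, sub_mul, one_mul, map_sub,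
    PowerSeries.coeff_X_pow_mul', PowerSeries.coeff_mk]
  split_ifs with h1 h2 h2
  · omega
  · simp
  · have := kneadingSign_add_period (f := f) σ hp h (n - p)
    rw [Nat.sub_add_cancel h2] at this
    simp [this]
  · omega

end Quadratic

end RealQuadratic

/-! ### Gaps between finitely many points of the line, and their images. -/

namespace RealQuadratic

/-- The `k`-th gap between the points `q 0, …, q n` of the line. -/
def gap {n : ℕ} (q : Fin (n + 1) → ℝ) (k : Fin n) : Set ℝ := Set.Ioo (q k.castSucc) (q k.succ)

/-- The midpoint of the `k`-th gap between the points `q 0, …, q n` of the line. -/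
noncomputable def gapMidpoint {n : ℕ} (q : Fin (n + 1) → ℝ) (k : Fin n) : ℝ :=
  (q k.castSucc + q k.succ) / 2

section Gaps

variable {n : ℕ} {q : Fin (n + 1) → ℝ}

theorem gapMidpoint_mem_gap (hq : StrictMono q) (k : Fin n) : gapMidpoint q k ∈ gap q k := by
  have := hq (Fin.castSucc_lt_succ (i := k))
  constructor <;> rw [gapMidpoint] <;> linarith

/-- No `q r` lies inside a gap, so a gap is wholly on one side of it. Hence the midpoint can stand
for the gap in all comparisons with orbit points. -/
theorem lt_iff_of_mem_gap (hq : StrictMono q) {k : Fin n} {x : ℝ} (hx : x ∈ gap q k)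
    (r : Fin (n + 1)) : x < q r ↔ k.castSucc < r := by
  refine ⟨fun h => ?_, fun h => hx.2.trans_le (hq.monotone (Fin.castSucc_lt_iff_succ_le.1 h))⟩
  by_contra hr
  exact absurd (hq.monotone (not_lt.1 hr)) (hx.1.trans h).not_ge

theorem gap_subset_Ioo_iff (hq : StrictMono q) (k : Fin n) (r s : Fin (n + 1)) :
    gap q k ⊆ Set.Ioo (q r) (q s) ↔ ¬ gapMidpoint q k < q r ∧ gapMidpoint q k < q s := by
  refine ⟨fun h => ?_, fun ⟨h1, h2⟩ x hx => ?_⟩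
  · have := h (gapMidpoint_mem_gap hq k)
    exact ⟨this.1.not_gt, this.2⟩
  · rw [lt_iff_of_mem_gap hq (gapMidpoint_mem_gap hq k)] at h1 h2
    exact ⟨(hq.monotone (not_lt.1 h1)).trans_lt hx.1, (lt_iff_of_mem_gap hq hx s).2 h2⟩

theorem gap_injective (hq : StrictMono q) : Function.Injective (gap q) := by
  have key : ∀ k l, gap q k = gap q l → k ≤ l := by
    intro k l h
    have h1 := gapMidpoint_mem_gap hq l
    have h2 := (lt_iff_of_mem_gap hq (h ▸ h1 : gapMidpoint q l ∈ gap q k) l.succ).1 h1.2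
    exact Fin.castSucc_lt_succ_iff.1 h2
  exact fun k l h => (key k l h).antisymm (key l k h.symm)

theorem exists_mem_gap {x : ℝ} (h0 : q 0 ≤ x) (hn : x ≤ q (Fin.last n))
    (hx : x ∉ Set.range q) : ∃ k, x ∈ gap q k := by
  by_contra! h
  have : ∀ r : Fin (n + 1), q r < x := by
    intro r
    induction r using Fin.induction with
    | zero => exact lt_of_le_of_ne h0 fun e => hx ⟨_, e⟩
    | succ k ih => exact lt_of_le_of_ne (not_lt.1 fun h' => h k ⟨ih, h'⟩) fun e => hx ⟨_, e⟩
  exact (this _).not_ge hn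

theorem gap_subset_compl_range (hq : StrictMono q) (k : Fin n) :
    gap q k ⊆ Set.Icc (q 0) (q (Fin.last n)) \ Set.range q := by
  intro x hx
  refine ⟨⟨(hq.monotone (Fin.zero_le _)).trans hx.1.le,
    hx.2.le.trans (hq.monotone (Fin.le_last _))⟩, ?_⟩
  rintro ⟨r, rfl⟩
  have h1 := hq.lt_iff_lt.1 hx.1
  have h2 := hq.lt_iff_lt.1 hx.2
  exact absurd (Fin.castSucc_lt_iff_succ_le.1 h1) h2.not_ge

theorem connectedComponentIn_eq_gap (hq : StrictMono q) {k : Fin n} {x : ℝ} (hx : x ∈ gap q k) :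
    connectedComponentIn (Set.Icc (q 0) (q (Fin.last n)) \ Set.range q) x = gap q k := by
  set F := Set.Icc (q 0) (q (Fin.last n)) \ Set.range q
  have hsub : gap q k ⊆ F := gap_subset_compl_range hq k
  have hconn := (isPreconnected_connectedComponentIn (x := x) (F := F)).ordConnected
  have hxc : x ∈ connectedComponentIn F x := mem_connectedComponentIn (hsub hx)
  have hno : ∀ r, q r ∉ connectedComponentIn F x := fun r h =>
    (connectedComponentIn_subset F x h).2 ⟨r, rfl⟩
  -- A connected set reaching outside the gap would contain one of its endpoints, which has been
  -- removed.
  refine subset_antisymm (fun y hy => ?_) (isPreconnected_Ioo.subset_connectedComponentIn hx hsub)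
  by_contra h
  rw [gap, Set.mem_Ioo, not_and_or, not_lt, not_lt] at h
  rcases h with h | h
  · exact hno _ (hconn.out hy hxc ⟨h, hx.1.le⟩)
  · exact hno _ (hconn.out hxc hy ⟨hx.2.le, h⟩)

/-- The image is the open interval between the images of the endpoints. These are again among the
points `q`, so covering a gap reduces to testing its midpoint. -/
theorem gap_subset_image_iff_of_strictMonoOn (hq : StrictMono q) {f : ℝ → ℝ} {j k : Fin n}
    (hc : Continuous f) (hf : StrictMonoOn f (Set.Icc (q j.castSucc) (q j.succ)))
    (hmaps : ∀ r, f (q r) ∈ Set.range q) :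
    gap q k ⊆ f '' gap q j ↔
      ¬ gapMidpoint q k < f (q j.castSucc) ∧ gapMidpoint q k < f (q j.succ) := by
  obtain ⟨r, hr⟩ := hmaps j.castSucc
  obtain ⟨s, hs⟩ := hmaps j.succ
  rw [gap.eq_def q j, hc.continuousOn.image_Ioo_of_strictMonoOn
    (hq Fin.castSucc_lt_succ).le hf, ← hr, ← hs, gap_subset_Ioo_iff hq]

theorem gap_subset_image_iff_of_strictAntiOn (hq : StrictMono q) {f : ℝ → ℝ} {j k : Fin n}
    (hc : Continuous f) (hf : StrictAntiOn f (Set.Icc (q j.castSucc) (q j.succ)))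
    (hmaps : ∀ r, f (q r) ∈ Set.range q) :
    gap q k ⊆ f '' gap q j ↔
      ¬ gapMidpoint q k < f (q j.succ) ∧ gapMidpoint q k < f (q j.castSucc) := by
  obtain ⟨r, hr⟩ := hmaps j.castSucc
  obtain ⟨s, hs⟩ := hmaps j.succ
  rw [gap.eq_def q j, hc.continuousOn.image_Ioo_of_strictAntiOn
    (hq Fin.castSucc_lt_succ).le hf, ← hr, ← hs, gap_subset_Ioo_iff hq]

/-- The indicator of `k`-th gap lying to the left of `x`. -/
noncomputable def leftIndicator (q : Fin (n + 1) → ℝ) (k : Fin n) (x : ℝ) : ℤ :=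
  if gapMidpoint q k < x then 1 else 0

theorem leftIndicator_apply (hq : StrictMono q) (k : Fin n) (r : Fin (n + 1)) :
    leftIndicator q k (q r) = if k.castSucc < r then 1 else 0 := by
  simp only [leftIndicator, lt_iff_of_mem_gap hq (gapMidpoint_mem_gap hq k)]

open Classical in
theorem ite_gap_subset_image_of_strictMonoOn (hq : StrictMono q) {f : ℝ → ℝ} {j k : Fin n}
    (hc : Continuous f) (hf : StrictMonoOn f (Set.Icc (q j.castSucc) (q j.succ)))
    (hmaps : ∀ r, f (q r) ∈ Set.range q) :
    (if gap q k ⊆ f '' gap q j then 1 else 0 : ℤ) =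
      leftIndicator q k (f (q j.succ)) - leftIndicator q k (f (q j.castSucc)) := by
  have hlt := hq (Fin.castSucc_lt_succ (i := j))
  have := hf (Set.left_mem_Icc.2 hlt.le) (Set.right_mem_Icc.2 hlt.le) hlt
  simp only [gap_subset_image_iff_of_strictMonoOn hq hc hf hmaps, leftIndicator]
  by_cases h1 : gapMidpoint q k < f (q j.castSucc)
  · simp [h1, h1.trans this]
  · simp [h1]

open Classical in
theorem ite_gap_subset_image_of_strictAntiOn (hq : StrictMono q) {f : ℝ → ℝ} {j k : Fin n}
    (hc : Continuous f) (hf : StrictAntiOn f (Set.Icc (q j.castSucc) (q j.succ)))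
    (hmaps : ∀ r, f (q r) ∈ Set.range q) :
    (if gap q k ⊆ f '' gap q j then 1 else 0 : ℤ) =
      leftIndicator q k (f (q j.castSucc)) - leftIndicator q k (f (q j.succ)) := by
  have hlt := hq (Fin.castSucc_lt_succ (i := j))
  have := hf (Set.left_mem_Icc.2 hlt.le) (Set.right_mem_Icc.2 hlt.le) hlt
  simp only [gap_subset_image_iff_of_strictAntiOn hq hc hf hmaps, leftIndicator]
  by_cases h1 : gapMidpoint q k < f (q j.succ)
  · simp [h1, h1.trans this]
  · simp [h1]

end Gaps

section Quadratic

variable {f : ℝ → ℝ} {a b x₀ : ℝ} {n : ℕ} {q : Fin (n + 1) → ℝ}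

theorem continuous_of_quadratic (hf : ∀ x, f x = a * (x - x₀) ^ 2 + b) : Continuous f := by
  rw [show f = fun x => a * (x - x₀) ^ 2 + b from funext hf]
  fun_prop

open Classical in
/-- The transition number of two gaps as an increment of the signed pullback of an indicator. -/
theorem ite_gap_subset_image (ha : a ≠ 0) (hf : ∀ x, f x = a * (x - x₀) ^ 2 + b)
    (hq : StrictMono q) (hx₀ : x₀ ∈ Set.range q) (hmaps : ∀ r, f (q r) ∈ Set.range q)
    (j k : Fin n) :
    (if gap q k ⊆ f '' gap q j then 1 else 0 : ℤ) =
      (SignType.sign a * SignType.sign (q j.succ - x₀) : SignType) *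
        (leftIndicator q k (f (q j.succ)) - leftIndicator q k (f x₀)) -
      (SignType.sign a * SignType.sign (q j.castSucc - x₀) : SignType) *
        (leftIndicator q k (f (q j.castSucc)) - leftIndicator q k (f x₀)) := by
  have hc := continuous_of_quadratic hf
  have hlt := hq (Fin.castSucc_lt_succ (i := j))
  -- An endpoint on either side of `x₀` contributes `±` the increment from `x₀`.
  have hge : ∀ x, x₀ ≤ x → ((SignType.sign a * SignType.sign (x - x₀) : SignType) : ℤ) *
      (leftIndicator q k (f x) - leftIndicator q k (f x₀)) =
      SignType.sign a * (leftIndicator q k (f x) - leftIndicator q k (f x₀)) := by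
    intro x hx
    rcases hx.eq_or_lt with rfl | h
    · simp
    · simp [sign_pos (sub_pos.2 h)]
  have hle : ∀ x, x ≤ x₀ → ((SignType.sign a * SignType.sign (x - x₀) : SignType) : ℤ) *
      (leftIndicator q k (f x) - leftIndicator q k (f x₀)) =
      -SignType.sign a * (leftIndicator q k (f x) - leftIndicator q k (f x₀)) := by
    intro x hx
    rcases hx.eq_or_lt with rfl | h
    · simp
    · simp [sign_neg (sub_neg.2 h)]
  obtain ⟨r, rfl⟩ := hx₀
  rcases le_or_gt r j.castSucc with h | h
  · have h1 : q r ≤ q j.castSucc := hq.monotone h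
    have hsub : Set.Icc (q j.castSucc) (q j.succ) ⊆ Set.Ici (q r) := fun x hx => h1.trans hx.1
    rw [hge _ h1, hge _ (h1.trans hlt.le)]
    rcases ha.lt_or_gt with h2 | h2
    · rw [ite_gap_subset_image_of_strictAntiOn hq hc ((strictAntiOn_Ici h2 hf).mono hsub) hmaps,
        sign_neg h2]
      simp only [SignType.coe_neg, SignType.coe_one]; ring
    · rw [ite_gap_subset_image_of_strictMonoOn hq hc ((strictMonoOn_Ici h2 hf).mono hsub) hmaps,
        sign_pos h2]
      simp only [SignType.coe_one]; ring
  · have h1 : q j.succ ≤ q r := hq.monotone (Fin.castSucc_lt_iff_succ_le.1 h)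
    have hsub : Set.Icc (q j.castSucc) (q j.succ) ⊆ Set.Iic (q r) := fun x hx => hx.2.trans h1
    rw [hle _ h1, hle _ (hlt.le.trans h1)]
    rcases ha.lt_or_gt with h2 | h2
    · rw [ite_gap_subset_image_of_strictMonoOn hq hc ((strictMonoOn_Iic h2 hf).mono hsub) hmaps,
        sign_neg h2]
      simp only [SignType.coe_neg, SignType.coe_one]; ring
    · rw [ite_gap_subset_image_of_strictAntiOn hq hc ((strictAntiOn_Iic h2 hf).mono hsub) hmaps,
        sign_pos h2]
      simp only [SignType.coe_one]; ring

end Quadratic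

end RealQuadratic

/-! ### Conjugating the transition matrix to a companion-like matrix. -/

namespace RealQuadratic

section Quadratic

variable {f : ℝ → ℝ} {a b x₀ : ℝ} {n : ℕ} {q : Fin (n + 1) → ℝ}

open Classical in
/-- The transition matrix of the gaps between the points `q 0, …, q n` of the line. -/
noncomputable def gapTransitionMatrix (f : ℝ → ℝ) (q : Fin (n + 1) → ℝ) :
    Matrix (Fin n) (Fin n) ℤ :=
  Matrix.of fun j k => if gap q k ⊆ f '' gap q j then 1 else 0

/-- The matrix integrating a function on the gaps from `x₀` to the points `f^[i + 1] x₀`. -/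
noncomputable def gapIntegrationMatrix (f : ℝ → ℝ) (x₀ : ℝ) (q : Fin (n + 1) → ℝ) :
    Matrix (Fin n) (Fin n) ℤ :=
  Matrix.of fun i k => leftIndicator q k (f^[(i : ℕ) + 1] x₀) - leftIndicator q k x₀

/-- The action of the transition matrix on integrals from `x₀` to the points `f^[i + 1] x₀`. -/
noncomputable def orbitTransitionMatrix (f : ℝ → ℝ) (x₀ : ℝ) (σ : SignType) (n : ℕ) :
    Matrix (Fin n) (Fin n) ℤ :=
  Matrix.of fun i j => (σ * SignType.sign (f^[(i : ℕ) + 1] x₀ - x₀) : SignType) *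
    ((if (j : ℕ) = i + 1 then 1 else 0) - if (j : ℕ) = 0 then 1 else 0)

/-- Each column of the transition matrix is the increment of a function `F` on the points that
vanishes at `x₀`. Integrating from `x₀` to `f^[i + 1] x₀` therefore telescopes to the value of `F`
there. -/
theorem gapIntegrationMatrix_mul (ha : a ≠ 0) (hf : ∀ x, f x = a * (x - x₀) ^ 2 + b)
    (hper : Function.minimalPeriod f x₀ = n + 1) (hq : StrictMono q)
    (hrange : Set.range q = Set.range fun i => f^[i] x₀) :
    gapIntegrationMatrix f x₀ q * gapTransitionMatrix f q =
      orbitTransitionMatrix f x₀ (SignType.sign a) n * gapIntegrationMatrix f x₀ q := by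
  have hmem : ∀ i, f^[i] x₀ ∈ Set.range q := fun i => hrange ▸ ⟨i, rfl⟩
  have hmaps : ∀ r, f (q r) ∈ Set.range q := by
    intro r
    obtain ⟨i, hi⟩ : q r ∈ Set.range fun i => f^[i] x₀ := hrange ▸ ⟨r, rfl⟩
    rw [← hi, ← Function.iterate_succ_apply' f i x₀]
    exact hmem _
  ext i k
  set F : Fin (n + 1) → ℤ := fun r =>
    (SignType.sign a * SignType.sign (q r - x₀) : SignType) *
      (leftIndicator q k (f (q r)) - leftIndicator q k (f x₀)) with hF
  obtain ⟨s, hs⟩ := hmem 0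
  obtain ⟨r, hr⟩ := hmem (i + 1)
  have hs' : q s = x₀ := hs
  have hFs : F s = 0 := by simp [hF, hs']
  have hA : ∀ j, gapTransitionMatrix f q j k = F j.succ - F j.castSucc := fun j =>
    ite_gap_subset_image ha hf hq ⟨s, hs'⟩ hmaps j k
  have hsum : ∀ r, ∑ j, leftIndicator q j (q r) * gapTransitionMatrix f q j k = F r - F 0 := by
    intro r
    rw [← Fin.sum_ite_castSucc_lt_sub]
    refine Finset.sum_congr rfl fun j _ => ?_
    rw [leftIndicator_apply hq, hA, ite_mul, one_mul, zero_mul]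
  have hleft : (gapIntegrationMatrix f x₀ q * gapTransitionMatrix f q) i k = F r := by
    simp only [Matrix.mul_apply, gapIntegrationMatrix, Matrix.of_apply, sub_mul,
      Finset.sum_sub_distrib, ← hr]
    rw [hsum, ← hs', hsum, hFs]
    ring
  have hright : (orbitTransitionMatrix f x₀ (SignType.sign a) n *
      gapIntegrationMatrix f x₀ q) i k = F r := by
    have hn : 0 < n := i.pos
    have h0 : ∑ j : Fin n, (if (j : ℕ) = 0 then (1 : ℤ) else 0) * gapIntegrationMatrix f x₀ q j k =
        leftIndicator q k (f x₀) - leftIndicator q k x₀ := by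
      rw [Finset.sum_eq_single ⟨0, hn⟩]
      · simp [gapIntegrationMatrix]
      · intro j _ hj
        rw [if_neg fun h => hj (Fin.ext h), zero_mul]
      · simp
    have h1 : ∑ j : Fin n, (if (j : ℕ) = i + 1 then (1 : ℤ) else 0) *
        gapIntegrationMatrix f x₀ q j k =
        leftIndicator q k (f^[(i : ℕ) + 2] x₀) - leftIndicator q k x₀ := by
      by_cases hi : (i : ℕ) + 1 < n
      · rw [Finset.sum_eq_single ⟨i + 1, hi⟩]
        · simp [gapIntegrationMatrix]
        · intro j _ hj
          rw [if_neg fun h => hj (Fin.ext h), zero_mul]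
        · simp
      -- In the last row the next orbit point is `x₀` itself, where the integral is `0`; this
      -- accounts for the missing superdiagonal entry.
      · have hi' : (i : ℕ) + 2 = n + 1 := by have := i.isLt; omega
        rw [hi', ← hper, Function.iterate_minimalPeriod, sub_self]
        refine Finset.sum_eq_zero fun j _ => ?_
        rw [if_neg (by have := j.isLt; omega), zero_mul]
    simp only [Matrix.mul_apply, orbitTransitionMatrix, Matrix.of_apply, mul_assoc, sub_mul]
    rw [← Finset.mul_sum, Finset.sum_sub_distrib, h0, h1, hF]
    simp only [hr, ← Function.iterate_succ_apply' f]
    ring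
  rw [hleft, hright]

/-- For a kernel vector `v` the integral has the same value at every orbit point, and its increment
across the `k`-th gap is `v k`. -/
theorem det_gapIntegrationMatrix_ne_zero (hper : Function.minimalPeriod f x₀ = n + 1)
    (hq : StrictMono q) (hrange : Set.range q = Set.range fun i => f^[i] x₀) :
    (gapIntegrationMatrix f x₀ q).det ≠ 0 := by
  intro h
  obtain ⟨v, hv, h0⟩ := Matrix.exists_mulVec_eq_zero_iff.2 h
  apply hv
  set H : ℝ → ℤ := fun x => ∑ k, leftIndicator q k x * v k with hH
  have hHi : ∀ i : Fin n, H (f^[(i : ℕ) + 1] x₀) = H x₀ := by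
    intro i
    have := congrFun h0 i
    simp only [Matrix.mulVec, dotProduct, gapIntegrationMatrix, Matrix.of_apply, sub_mul,
      Finset.sum_sub_distrib, Pi.zero_apply] at this
    exact sub_eq_zero.1 this
  have hconst : ∀ r, H (q r) = H x₀ := by
    intro r
    obtain ⟨i, hi⟩ : q r ∈ Set.range fun i => f^[i] x₀ := hrange ▸ ⟨r, rfl⟩
    rw [← hi]
    dsimp only
    rw [← Function.iterate_mod_minimalPeriod_eq, hper]
    have hlt : i % (n + 1) < n + 1 := Nat.mod_lt _ n.succ_pos
    rcases h : i % (n + 1) with _ | m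
    · simp
    · exact hHi ⟨m, by omega⟩
  funext k
  have h1 : H (q k.succ) - H (q k.castSucc) = v k := by
    simp only [hH, ← Finset.sum_sub_distrib, ← sub_mul, leftIndicator_apply hq]
    rw [Finset.sum_eq_single k]
    · simp
    · intro j _ hj
      rcases hj.lt_or_gt with h | h
      · simp [h, h.le]
      · simp [h.not_ge, h.not_gt]
    · simp
  rw [← h1, hconst, hconst, sub_self, Pi.zero_apply]

open Polynomial in
theorem det_one_sub_orbitTransitionMatrix (σ : SignType)
    (hper : Function.minimalPeriod f x₀ = n + 1) :
    (1 - (X : ℤ[X]) • (orbitTransitionMatrix f x₀ σ n).map C).det =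
      kneadingPolynomial f x₀ σ (n + 1) := by
  set u : ℕ → ℤ[X] := fun i => X * C ((σ * SignType.sign (f^[i + 1] x₀ - x₀) : SignType) : ℤ)
    with hu
  have hM : 1 - (X : ℤ[X]) • (orbitTransitionMatrix f x₀ σ n).map C =
      Matrix.of fun i j : Fin n => (if i = j then 1 else 0) -
        u i * ((if (j : ℕ) = i + 1 then 1 else 0) - if (j : ℕ) = 0 then 1 else 0) := by
    ext1 i j
    simp only [Matrix.sub_apply, Matrix.one_apply, Matrix.smul_apply, Matrix.map_apply,
      orbitTransitionMatrix, Matrix.of_apply, smul_eq_mul, hu, C_mul, C_sub, mul_assoc]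
    split_ifs <;> simp
  rw [hM, det_one_sub_companion, kneadingPolynomial]
  refine Finset.sum_congr rfl fun i hi => ?_
  rw [Finset.mem_range] at hi
  induction i with
  | zero => simp [kneadingSign]
  -- Below the minimal period the orbit does not return to `x₀`, so the reset branch of
  -- `kneadingSign` is never used.
  | succ i ih =>
    have hne : f^[i + 1] x₀ ≠ x₀ := fun h =>
      Function.not_isPeriodicPt_of_pos_of_lt_minimalPeriod i.succ_ne_zero (hper ▸ hi) h
    rw [Finset.prod_range_succ, ih (by omega), kneadingSign, if_neg hne, hu]
    push_cast
    simp only [C_mul]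
    ring

open Polynomial in
theorem det_one_sub_gapTransitionMatrix (ha : a ≠ 0) (hf : ∀ x, f x = a * (x - x₀) ^ 2 + b)
    (hper : Function.minimalPeriod f x₀ = n + 1) (hq : StrictMono q)
    (hrange : Set.range q = Set.range fun i => f^[i] x₀) :
    (1 - (X : ℤ[X]) • (gapTransitionMatrix f q).map C).det =
      kneadingPolynomial f x₀ (SignType.sign a) (n + 1) := by
  set S := gapIntegrationMatrix f x₀ q with hS
  -- A nonzero determinant is enough: it is cancelled in the domain `ℤ[X]`, so the inverse of `S` is
  -- not needed.
  have hdet : (S.map (C : ℤ →+* ℤ[X])).det ≠ 0 := by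
    rw [← RingHom.mapMatrix_apply, ← RingHom.map_det, Ne, C_eq_zero]
    exact det_gapIntegrationMatrix_ne_zero hper hq hrange
  have hmul : S.map C * (1 - (X : ℤ[X]) • (gapTransitionMatrix f q).map C) =
      (1 - (X : ℤ[X]) • (orbitTransitionMatrix f x₀ (SignType.sign a) n).map C) * S.map C := by
    rw [mul_sub, sub_mul, mul_one, one_mul, Matrix.mul_smul, Matrix.smul_mul, ← Matrix.map_mul,
      ← Matrix.map_mul, gapIntegrationMatrix_mul ha hf hper hq hrange]
  have h := congrArg Matrix.det hmul
  rw [Matrix.det_mul, Matrix.det_mul, mul_comm] at h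
  rw [mul_right_cancel₀ hdet h, det_one_sub_orbitTransitionMatrix _ hper]

end Quadratic

theorem exists_strictMono_range_eq_orbit {f : ℝ → ℝ} {x₀ : ℝ} {n : ℕ}
    (hper : Function.minimalPeriod f x₀ = n + 1) :
    ∃ q : Fin (n + 1) → ℝ, StrictMono q ∧ Set.range q = Set.range fun i => f^[i] x₀ := by
  classical
  set s : Finset ℝ := (Finset.range (n + 1)).image fun i => f^[i] x₀ with hs
  have hcard : s.card = n + 1 := by
    rw [hs, Finset.card_image_of_injOn, Finset.card_range]
    intro i hi j hj h
    simp only [Finset.coe_range, Set.mem_Iio, ← hper] at hi hj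
    exact Function.iterate_injOn_Iio_minimalPeriod hi hj h
  refine ⟨s.orderEmbOfFin hcard, (s.orderEmbOfFin hcard).strictMono, ?_⟩
  rw [Finset.range_orderEmbOfFin, hs]
  ext x
  simp only [Finset.coe_image, Finset.coe_range, Set.mem_image, Set.mem_Iio, Set.mem_range]
  constructor
  · rintro ⟨i, -, h⟩
    exact ⟨i, h⟩
  · rintro ⟨i, h⟩
    refine ⟨i % (n + 1), Nat.mod_lt _ n.succ_pos, ?_⟩
    rw [← hper, Function.iterate_mod_minimalPeriod_eq, h]

/-! ### Identifying the postcritical partition with the gaps of the critical orbit. -/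

section Partition

variable {f : ℝ → ℝ} {x₀ : ℝ} {n : ℕ} {q : Fin (n + 1) → ℝ}

theorem hubbardTree_eq_Icc (hq : StrictMono q)
    (hrange : Set.range q = Set.range fun i => f^[i] x₀) :
    hubbardTree f x₀ = Set.Icc (q 0) (q (Fin.last n)) := by
  have hmem : ∀ i, f^[i] x₀ ∈ Set.Icc (q 0) (q (Fin.last n)) := by
    intro i
    obtain ⟨r, hr⟩ : f^[i] x₀ ∈ Set.range q := hrange ▸ ⟨i, rfl⟩
    rw [← hr]
    exact ⟨hq.monotone (Fin.zero_le _), hq.monotone (Fin.le_last _)⟩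
  refine subset_antisymm (Set.iUnion₂_subset fun i j => ?_) fun x hx => ?_
  · exact Set.uIcc_subset_Icc (hmem i) (hmem j)
  · obtain ⟨i, hi⟩ : q 0 ∈ Set.range fun i => f^[i] x₀ := hrange ▸ ⟨0, rfl⟩
    obtain ⟨j, hj⟩ : q (Fin.last n) ∈ Set.range fun i => f^[i] x₀ := hrange ▸ ⟨_, rfl⟩
    refine Set.mem_iUnion₂.2 ⟨i, j, Set.Icc_subset_uIcc ?_⟩
    dsimp only at hi hj
    rwa [hi, hj]

theorem postcriticalSet_eq_range (hper : Function.minimalPeriod f x₀ = n + 1)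
    (hrange : Set.range q = Set.range fun i => f^[i] x₀) :
    postcriticalSet f x₀ = Set.range q := by
  rw [hrange]
  refine subset_antisymm ?_ ?_
  · rintro _ ⟨i, rfl⟩
    exact ⟨i + 1, rfl⟩
  · rintro _ ⟨i, rfl⟩
    -- The postcritical set starts at `f x₀`, so the index is advanced by a full period `n + 1`.
    refine ⟨i + n, ?_⟩
    dsimp only
    rw [add_assoc, ← hper, Function.iterate_add_apply, Function.iterate_minimalPeriod]

theorem postcriticalPartition_eq_range_gap (hper : Function.minimalPeriod f x₀ = n + 1)
    (hq : StrictMono q) (hrange : Set.range q = Set.range fun i => f^[i] x₀) :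
    postcriticalPartition f x₀ = Set.range (gap q) := by
  rw [postcriticalPartition, hubbardTree_eq_Icc hq hrange, postcriticalSet_eq_range hper hrange]
  ext J
  constructor
  · rintro ⟨x, hx, rfl⟩
    obtain ⟨k, hk⟩ := exists_mem_gap hx.1.1 hx.1.2 hx.2
    exact ⟨k, (connectedComponentIn_eq_gap hq hk).symm⟩
  · rintro ⟨k, rfl⟩
    have hk := gapMidpoint_mem_gap hq k
    exact ⟨_, gap_subset_compl_range hq k hk, (connectedComponentIn_eq_gap hq hk).symm⟩

/-- The postcritical partition is indexed by the gaps of the critical orbit. -/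
noncomputable def gapEquiv (hper : Function.minimalPeriod f x₀ = n + 1) (hq : StrictMono q)
    (hrange : Set.range q = Set.range fun i => f^[i] x₀) :
    Fin n ≃ postcriticalPartition f x₀ :=
  (Equiv.ofInjective _ (gap_injective hq)).trans
    (Equiv.setCongr (postcriticalPartition_eq_range_gap hper hq hrange).symm)

theorem transitionMatrix_submatrix_gapEquiv (hper : Function.minimalPeriod f x₀ = n + 1)
    (hq : StrictMono q) (hrange : Set.range q = Set.range fun i => f^[i] x₀) :
    (transitionMatrix f x₀).submatrix (gapEquiv hper hq hrange) (gapEquiv hper hq hrange) =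
      gapTransitionMatrix f q := rfl

end Partition

end RealQuadratic

/-! ### Completing the square, and the main theorem. -/

theorem Polynomial.eval_eq_of_natDegree_eq_two {f : Polynomial ℝ} (hf : f.natDegree = 2) {x₀ : ℝ}
    (hx₀ : f.derivative.eval x₀ = 0) (x : ℝ) :
    f.eval x = f.coeff 2 * (x - x₀) ^ 2 + f.eval x₀ := by
  have hsum : f = C (f.coeff 2) * X ^ 2 + C (f.coeff 1) * X + C (f.coeff 0) := by
    conv_lhs => rw [f.as_sum_range_C_mul_X_pow, hf]
    simp [Finset.sum_range_succ]
    ring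
  generalize f.coeff 2 = a at *
  generalize f.coeff 1 = b at *
  generalize f.coeff 0 = c at *
  subst hsum
  simp at hx₀ ⊢
  linear_combination (x - x₀) * hx₀

open RealQuadratic in
theorem mainTheorem11 (f : Polynomial ℝ) (hf : f.natDegree = 2)
    (x₀ : ℝ) (hx₀ : f.derivative.eval x₀ = 0)
    (p : ℕ) (hp : 0 < p) (hper : Function.minimalPeriod (fun x => f.eval x) x₀ = p) :
    (postcriticalPartition (fun x => f.eval x) x₀).Finite ∧
    ∃ P : Polynomial ℤ,
      P.degree = ((p - 1 : ℕ) : WithBot ℕ) ∧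
      (P : PowerSeries ℤ) =
        (1 - PowerSeries.X ^ p) * kneadingDeterminant (fun x => f.eval x) x₀ ∧
      ∀ [Fintype (postcriticalPartition (fun x => f.eval x) x₀)]
        [DecidableEq (postcriticalPartition (fun x => f.eval x) x₀)],
        (1 - (Polynomial.X : Polynomial ℤ) •
          (transitionMatrix (fun x => f.eval x) x₀).map Polynomial.C).det = P := by
  have ha : f.coeff 2 ≠ 0 := by
    rw [← hf, Polynomial.coeff_natDegree, Polynomial.leadingCoeff_ne_zero]
    rintro rfl
    simp at hf
  have hfx := Polynomial.eval_eq_of_natDegree_eq_two hf hx₀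
  obtain ⟨n, rfl⟩ := Nat.exists_eq_add_one_of_ne_zero hp.ne'
  obtain ⟨q, hq, hrange⟩ := exists_strictMono_range_eq_orbit hper
  have hσ : SignType.sign (f.coeff 2) ≠ 0 := by simpa [sign_eq_zero_iff] using ha
  have hperiodic : Function.IsPeriodicPt (fun x => f.eval x) (n + 1) x₀ :=
    hper ▸ Function.isPeriodicPt_minimalPeriod _ _
  refine ⟨?_, kneadingPolynomial (fun x => f.eval x) x₀ (SignType.sign (f.coeff 2)) (n + 1),
    ?_, ?_, ?_⟩
  · rw [postcriticalPartition_eq_range_gap hper hq hrange]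
    exact Set.finite_range _
  · rw [degree_kneadingPolynomial hσ, Nat.add_sub_cancel]
  · rw [kneadingDeterminant_eq ha hfx, coe_kneadingPolynomial _ hp hperiodic]
  · intro _ _
    set e := gapEquiv hper hq hrange
    have hsub : (1 - (Polynomial.X : Polynomial ℤ) •
        (transitionMatrix (fun x => f.eval x) x₀).map Polynomial.C).submatrix e e =
        1 - (Polynomial.X : Polynomial ℤ) •
          (gapTransitionMatrix (fun x => f.eval x) q).map Polynomial.C := by
      ext1 i j
      simp [← transitionMatrix_submatrix_gapEquiv hper hq hrange, Matrix.one_apply, e]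
    rw [← Matrix.det_submatrix_equiv_self e, hsub]
    exact det_one_sub_gapTransitionMatrix ha hfx hper hq hrange
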